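/- Consider quantum query algorithms for deciding \textsc{Connectivity} of undirected simple graphs on $n$ labelled vertices in the adjacency matrix model: the input graph $G$ with adjacency matrix $M\in\{0,1\}^{n\times n}$ is accessed only through queries $|i,j\rangle|b\rangle|w\rangle\mapsto|i,j\rangle|b\oplus M_{ij}\rangle|w\rangle$ (with a workspace register $w$ of arbitrary finite dimension), interleaved with arbitrary unitaries that do not depend on $G$, starting from a fixed basis state and ending with a measurement in the computational basis whose outcome determines whether the algorithm accepts or rejects. Theorem. \textsc{Connectivity} needs $\Omega(n^{3/2})$ quantum queries in the adjacency matrix model. That is, for every error bound $0\le\varepsilon<1/2$ there are a constant $c>0$ and an $n_0$ (depending only on $\varepsilon$) such that for every $n\ge n_0$, every quantum query algorithm which accepts every connected graph on $n$ vertices with probability at least $1-\varepsilon$ and every disconnected graph on $n$ vertices with probability at most $\varepsilon$ makes at least $c\,n^{3/2}$ queries. -/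

import Mathlib

/-- A quantum query algorithm for inputs `x : ι → Bool` (black-box access to the bits
of `x`). The computational basis states are `|i, b, w⟩`: a query register `i : ι`, an answer
bit `b`, and a workspace of arbitrary finite dimension `workDim`. The algorithm starts in the basis
state `start`, applies `U 0`, a query, `U 1`, a query, ..., a query, `U queries` (the matrices
`U t` with `queries < t` are not used), and finally measures in the computational basis; it accepts
iff the outcome lies in `accept`. -/
structure QuantumQueryAlgorithm (ι : Type) [Fintype ι] [DecidableEq ι] where
  /-- The dimension of the workspace. -/
  workDim : ℕ
  /-- The number of queries made. -/
  queries : ℕ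
  /-- The initial basis state. -/
  start : ι × Bool × Fin workDim
  /-- The input-independent unitaries. -/
  U : ℕ → Matrix.unitaryGroup (ι × Bool × Fin workDim) ℂ
  /-- The accepting measurement outcomes. -/
  accept : Finset (ι × Bool × Fin workDim)

namespace QuantumQueryAlgorithm

/-- The query operator `|i, b, w⟩ ↦ |i, b ⊕ x i, w⟩`, acting on vectors of amplitudes. As the map on
basis states is an involution, the new amplitude at `(i, b, w)` is the old one at
`(i, b ⊕ x i, w)`. -/
def query {ι : Type} {d : ℕ} (x : ι → Bool) (ψ : ι × Bool × Fin d → ℂ) :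
    ι × Bool × Fin d → ℂ :=
  fun s => ψ (s.1, xor s.2.1 (x s.1), s.2.2)

variable {ι : Type} [Fintype ι] [DecidableEq ι]

/-- The state of the algorithm on input `x` just after `t` queries and the unitary `U t`. -/
noncomputable def state (A : QuantumQueryAlgorithm ι) (x : ι → Bool) : ℕ → (ι × Bool × Fin A.workDim → ℂ)
  | 0 => (A.U 0 : Matrix _ _ ℂ).mulVec (Pi.single A.start 1)
  | t + 1 => (A.U (t + 1) : Matrix _ _ ℂ).mulVec (query x (A.state x t))

/-- The probability that the algorithm accepts the input `x`. -/
noncomputable def acceptProb (A : QuantumQueryAlgorithm ι) (x : ι → Bool) : ℝ :=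
  ∑ s ∈ A.accept, ‖A.state x A.queries s‖ ^ 2

end QuantumQueryAlgorithm

open Classical in
/-- The adjacency matrix of an undirected graph, as a table of `n × n` bits that can be queried. -/
noncomputable def adjacencyBits {n : ℕ} (G : SimpleGraph (Fin n)) : Fin n × Fin n → Bool :=
  fun p => decide (G.Adj p.1 p.2)

/-- In the adjacency matrix model, the algorithm `A` decides Connectivity of undirected graphs on
`n` vertices, with error probability at most `ε` on every input. -/
def DecidesConnectivity {n : ℕ} (A : QuantumQueryAlgorithm (Fin n × Fin n)) (ε : ℝ) : Prop :=
  ∀ G : SimpleGraph (Fin n),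
    (G.Connected → 1 - ε ≤ A.acceptProb (adjacencyBits G)) ∧
    (¬ G.Connected → A.acceptProb (adjacencyBits G) ≤ ε)

/-! ### The quantum adversary method. -/

namespace QuantumQueryAlgorithm

open Finset

/-! Adversary argument. The states on a connected and a disconnected input start with overlap 1 and
must end with overlap bounded away from 1, while one query changes the overlap only through
positions where the inputs differ (`norm_overlap_succ_sub_le`). The pairs are an `n`-cycle and the
two cycles obtained by exchanging two of its edges, for `m = n / 3` cut points `k` and all `n!`
relabellings `σ`. Each cycle of the split has at least `m` vertices. By Cauchy–Schwarz, each changed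
edge costs at most `√(X * Y)`, where `X`, `Y` are the query weights it receives on the two sides,
summed over all pairs. Symmetries of the permutations spread this weight
(`sum_relabelledWeight_le`). For new edges, `X ≤ n!/n` and `Y ≤ n!`; for removed edges, `X ≤ m n!/n`
and `Y ≤ n!/m`. Both give `n!/√n`, against a total overlap of `m n!`, so order `m√n` queries are
needed. -/

theorem sum_query {ι : Type} (x : ι → Bool) {d : ℕ} (F : ι × Bool × Fin d → ℂ) (i : ι) :
    ∑ r : Bool × Fin d, F (i, xor r.1 (x i), r.2) = ∑ r : Bool × Fin d, F (i, r) := by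
  rw [Fintype.sum_prod_type, Fintype.sum_prod_type, Fintype.sum_bool, Fintype.sum_bool]
  cases x i <;> simp [add_comm]

theorem star_query_dotProduct_query_self {ι : Type} [Fintype ι] (x : ι → Bool) {d : ℕ} (v w : ι × Bool × Fin d → ℂ) :
    star (query x v) ⬝ᵥ query x w = star v ⬝ᵥ w := by
  simp only [dotProduct]
  rw [Fintype.sum_prod_type, Fintype.sum_prod_type]
  exact sum_congr rfl fun i _ => sum_query x (fun s => star v s * w s) i

variable {ι : Type} [Fintype ι] [DecidableEq ι]

/-- The probability that a measurement just before query `t + 1` finds the query register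
in state `i`. -/
noncomputable def queryWeight (A : QuantumQueryAlgorithm ι) (x : ι → Bool) (t : ℕ) (i : ι) : ℝ :=
  ∑ r : Bool × Fin A.workDim, ‖A.state x t (i, r)‖ ^ 2

/-- The inner product of the states on inputs `x` and `y`. -/
noncomputable def overlap (A : QuantumQueryAlgorithm ι) (x y : ι → Bool) (t : ℕ) : ℂ :=
  star (A.state x t) ⬝ᵥ A.state y t

theorem star_mulVec_dotProduct_mulVec {m : Type*} [Fintype m] [DecidableEq m]
    (U : Matrix.unitaryGroup m ℂ) (v w : m → ℂ) :
    star ((U : Matrix m m ℂ).mulVec v) ⬝ᵥ (U : Matrix m m ℂ).mulVec w = star v ⬝ᵥ w := by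
  rw [Matrix.star_mulVec, Matrix.dotProduct_mulVec, Matrix.vecMul_vecMul,
    ← Matrix.star_eq_conjTranspose, Unitary.coe_star_mul_self, Matrix.vecMul_one]

theorem star_dotProduct_self {m : Type*} [Fintype m] (v : m → ℂ) :
    star v ⬝ᵥ v = ((∑ s, ‖v s‖ ^ 2 : ℝ) : ℂ) := by
  simp only [dotProduct, Pi.star_apply, Complex.ofReal_sum]
  refine sum_congr rfl fun s _ => ?_
  rw [Complex.star_def, Complex.conj_mul']
  push_cast
  rfl

theorem overlap_zero (A : QuantumQueryAlgorithm ι) (x y : ι → Bool) : A.overlap x y 0 = 1 := by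
  simp only [overlap, state]
  rw [star_mulVec_dotProduct_mulVec]
  simp

theorem overlap_self (A : QuantumQueryAlgorithm ι) (x : ι → Bool) (t : ℕ) :
    A.overlap x x t = 1 := by
  induction t with
  | zero => exact A.overlap_zero x x
  | succ t ih =>
    rw [← ih]
    simp only [overlap, state]
    rw [star_mulVec_dotProduct_mulVec, star_query_dotProduct_query_self]

theorem sum_norm_sq_state (A : QuantumQueryAlgorithm ι) (x : ι → Bool) (t : ℕ) :
    ∑ s, ‖A.state x t s‖ ^ 2 = 1 := by
  have h := A.overlap_self x t
  rw [overlap, star_dotProduct_self] at h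
  exact_mod_cast h

theorem queryWeight_nonneg (A : QuantumQueryAlgorithm ι) (x : ι → Bool) (t : ℕ) (i : ι) :
    0 ≤ A.queryWeight x t i :=
  sum_nonneg fun _ _ => by positivity

theorem sum_queryWeight (A : QuantumQueryAlgorithm ι) (x : ι → Bool) (t : ℕ) :
    ∑ i, A.queryWeight x t i = 1 := by
  rw [← A.sum_norm_sq_state x t, Fintype.sum_prod_type]
  rfl

theorem norm_sum_star_mul_le {κ : Type*} (s : Finset κ) (v w : κ → ℂ) :
    ‖∑ r ∈ s, star (v r) * w r‖ ≤ √(∑ r ∈ s, ‖v r‖ ^ 2) * √(∑ r ∈ s, ‖w r‖ ^ 2) :=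
  calc ‖∑ r ∈ s, star (v r) * w r‖ ≤ ∑ r ∈ s, ‖v r‖ * ‖w r‖ := by
        refine (norm_sum_le _ _).trans (sum_le_sum fun r _ => ?_)
        rw [norm_mul, norm_star]
    _ ≤ _ := Real.sum_mul_le_sqrt_mul_sqrt _ _ _

theorem sum_norm_sq_query (A : QuantumQueryAlgorithm ι) (x : ι → Bool) (t : ℕ) (i : ι) :
    ∑ r : Bool × Fin A.workDim, ‖query x (A.state x t) (i, r)‖ ^ 2 = A.queryWeight x t i := by
  have h := sum_query x (fun s => ((‖A.state x t s‖ ^ 2 : ℝ) : ℂ)) i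
  exact_mod_cast h

/-- Unitaries preserve the overlap, and where `x i = y i` the query permutes block `i` identically
in both states. Each remaining block is bounded by Cauchy–Schwarz before and after the query, whence
the factor 2. -/
theorem norm_overlap_succ_sub_le (A : QuantumQueryAlgorithm ι) (x y : ι → Bool) (t : ℕ) :
    ‖A.overlap x y (t + 1) - A.overlap x y t‖ ≤
      2 * ∑ i with x i ≠ y i, √(A.queryWeight x t i) * √(A.queryWeight y t i) := by
  have h : A.overlap x y (t + 1) - A.overlap x y t =
      ∑ i with x i ≠ y i,
        (∑ r : Bool × Fin A.workDim,
          star (query x (A.state x t) (i, r)) * query y (A.state y t) (i, r) -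
        ∑ r : Bool × Fin A.workDim, star (A.state x t (i, r)) * A.state y t (i, r)) := by
    simp only [overlap, state]
    rw [star_mulVec_dotProduct_mulVec]
    simp only [dotProduct]
    rw [Fintype.sum_prod_type, Fintype.sum_prod_type, ← sum_sub_distrib, sum_filter]
    refine sum_congr rfl fun i _ => ?_
    split_ifs with hi
    · rfl
    · rw [sub_eq_zero, ← sum_query x (fun s => star (A.state x t) s * A.state y t s) i]
      refine sum_congr rfl fun r _ => ?_
      simp only [Pi.star_apply, query]
      rw [not_not.mp hi]
  rw [h, mul_sum]
  refine (norm_sum_le _ _).trans (sum_le_sum fun i _ => (norm_sub_le _ _).trans ?_)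
  rw [two_mul]
  refine add_le_add ?_ (norm_sum_star_mul_le _ _ _)
  rw [← A.sum_norm_sq_query x t i, ← A.sum_norm_sq_query y t i]
  exact norm_sum_star_mul_le _ _ _

/-- Fidelity against distance for two Bernoulli laws: bound the cross term of the square by AM-GM.
-/
theorem sqrt_mul_add_sqrt_mul_sq_le {a b : ℝ} (ha : 0 ≤ a) (ha' : a ≤ 1) (hb : 0 ≤ b)
    (hb' : b ≤ 1) : (√a * √b + √(1 - a) * √(1 - b)) ^ 2 ≤ 1 - (a - b) ^ 2 := by
  have h1 := Real.sq_sqrt ha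
  have h2 := Real.sq_sqrt hb
  have h3 := Real.sq_sqrt (sub_nonneg.2 ha')
  have h4 := Real.sq_sqrt (sub_nonneg.2 hb')
  have h5 : (√a * √b + √(1 - a) * √(1 - b)) ^ 2 =
    √a ^ 2 * √b ^ 2 + √(1 - a) ^ 2 * √(1 - b) ^ 2 + 2 * (√a * √(1 - a)) * (√b * √(1 - b)) := by
    ring
  have h6 : (√a * √(1 - a) - √b * √(1 - b)) ^ 2 = √a ^ 2 * √(1 - a) ^ 2 + √b ^ 2 * √(1 - b) ^ 2
    - 2 * (√a * √(1 - a)) * (√b * √(1 - b)) := by ring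
  have h7 := sq_nonneg (√a * √(1 - a) - √b * √(1 - b))
  rw [h1, h2, h3, h4] at h5 h6
  nlinarith

theorem norm_overlap_final_le (A : QuantumQueryAlgorithm ι) (x y : ι → Bool) {ε : ℝ}
    (hε : ε < 1 / 2) (hx : 1 - ε ≤ A.acceptProb x) (hy : A.acceptProb y ≤ ε) :
    ‖A.overlap x y A.queries‖ ≤ √(1 - (1 - 2 * ε) ^ 2) := by
  have hc (z : ι → Bool) : ∑ s ∈ A.acceptᶜ, ‖A.state z A.queries s‖ ^ 2 = 1 - A.acceptProb z := by
    rw [eq_sub_iff_add_eq, acceptProb, sum_compl_add_sum, sum_norm_sq_state]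
  have h0 (z : ι → Bool) : 0 ≤ A.acceptProb z := sum_nonneg fun _ _ => by positivity
  have h1 (z : ι → Bool) : A.acceptProb z ≤ 1 := by
    rw [← sub_nonneg, ← hc]
    exact sum_nonneg fun _ _ => by positivity
  apply Real.le_sqrt_of_sq_le
  have h2 : ‖A.overlap x y A.queries‖ ≤ √(A.acceptProb x) * √(A.acceptProb y) +
      √(1 - A.acceptProb x) * √(1 - A.acceptProb y) := by
    rw [overlap, dotProduct, ← sum_add_sum_compl A.accept]
    refine (norm_add_le _ _).trans (add_le_add ?_ ?_)
    · exact norm_sum_star_mul_le _ _ _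
    · rw [← hc, ← hc]
      exact norm_sum_star_mul_le _ _ _
  calc _ ≤ _ := pow_le_pow_left₀ (norm_nonneg _) h2 2
    _ ≤ _ := sqrt_mul_add_sqrt_mul_sq_le (h0 x) (h1 x) (h0 y) (h1 y)
    _ ≤ _ := by nlinarith

/-- The adversary bound, for a family of pairs of inputs that the algorithm must distinguish. -/
theorem adversary_bound (A : QuantumQueryAlgorithm ι) {ε B : ℝ} (hε : ε < 1 / 2)
    {κ : Type*} (E : Finset κ) (x y : κ → ι → Bool)
    (hx : ∀ e ∈ E, 1 - ε ≤ A.acceptProb (x e)) (hy : ∀ e ∈ E, A.acceptProb (y e) ≤ ε)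
    (hB : ∀ t, ∑ e ∈ E, ∑ i with x e i ≠ y e i,
      √(A.queryWeight (x e) t i) * √(A.queryWeight (y e) t i) ≤ B) :
    (1 - √(1 - (1 - 2 * ε) ^ 2)) * #E ≤ 2 * B * A.queries := by
  -- The total overlap starts at `#E` and drops by at most `2 * B` per query.
  have hstep (t : ℕ) : (#E : ℝ) - ∑ e ∈ E, ‖A.overlap (x e) (y e) t‖ ≤ 2 * B * t := by
    induction t with
    | zero => simp [overlap_zero]
    | succ t ih =>
      have h : ∑ e ∈ E, ‖A.overlap (x e) (y e) t‖ ≤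
          ∑ e ∈ E, (‖A.overlap (x e) (y e) (t + 1)‖ + 2 * ∑ i with x e i ≠ y e i,
            √(A.queryWeight (x e) t i) * √(A.queryWeight (y e) t i)) := by
        refine sum_le_sum fun e _ => ?_
        have h1 := A.norm_overlap_succ_sub_le (x e) (y e) t
        have h2 := norm_sub_norm_le (A.overlap (x e) (y e) t) (A.overlap (x e) (y e) (t + 1))
        rw [norm_sub_rev] at h2
        linarith
      rw [sum_add_distrib, ← mul_sum] at h
      push_cast
      linarith [hB t]
  have hfin : ∑ e ∈ E, ‖A.overlap (x e) (y e) A.queries‖ ≤ #E * √(1 - (1 - 2 * ε) ^ 2) := by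
    rw [← nsmul_eq_mul]
    exact sum_le_card_nsmul _ _ _ fun e he => A.norm_overlap_final_le _ _ hε (hx e he) (hy e he)
  linarith [hstep A.queries]

end QuantumQueryAlgorithm

/-- The graph of a permutation: every vertex is joined to its image. -/
def Equiv.Perm.graph {V : Type*} (π : Equiv.Perm V) : SimpleGraph V :=
  SimpleGraph.fromRel fun u v => π u = v

/-! ### Permutation graphs and averaging over relabellings. -/

section PermutationGraphs

open Finset

variable {V : Type*}

theorem Equiv.Perm.graph_adj {π : Equiv.Perm V} {u v : V} :
    π.graph.Adj u v ↔ u ≠ v ∧ (π u = v ∨ π v = u) :=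
  SimpleGraph.fromRel_adj _ _ _

theorem Equiv.Perm.graph_reachable_iff {π : Equiv.Perm V} {u v : V} :
    π.graph.Reachable u v ↔ π.SameCycle u v := by
  constructor
  · rintro ⟨p⟩
    induction p with
    | nil => exact Equiv.Perm.SameCycle.refl _ _
    | cons h _ ih =>
      refine Equiv.Perm.SameCycle.trans ?_ ih
      rcases (Equiv.Perm.graph_adj.1 h).2 with h | h
      · exact ⟨1, by simpa using h⟩
      · exact ⟨-1, by simp [← h]⟩
  · have step (u : V) : π.graph.Reachable u (π u) := by
      by_cases h : u = π u
      · rw [← h]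
      · exact SimpleGraph.Adj.reachable (Equiv.Perm.graph_adj.2 ⟨h, Or.inl rfl⟩)
    have steps (i : ℕ) (u : V) : π.graph.Reachable u ((π ^ i) u) := by
      induction i with
      | zero => exact SimpleGraph.Reachable.refl _
      | succ i ih =>
        rw [pow_succ']
        exact ih.trans (step _)
    rintro ⟨i, rfl⟩
    obtain ⟨j, rfl | rfl⟩ := i.eq_nat_or_neg
    · exact steps j u
    · simpa using (steps j ((π ^ (-(j : ℤ))) u)).symm

theorem Equiv.Perm.graph_connected_iff [Nonempty V] {π : Equiv.Perm V} :
    π.graph.Connected ↔ ∀ u v, π.SameCycle u v := by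
  rw [SimpleGraph.connected_iff, and_iff_left ‹_›]
  exact forall₂_congr fun _ _ => Equiv.Perm.graph_reachable_iff

theorem Equiv.Perm.graph_conj_connected_iff [Nonempty V] {π : Equiv.Perm V} (σ : Equiv.Perm V) :
    (σ * π * σ⁻¹).graph.Connected ↔ π.graph.Connected := by
  simp only [Equiv.Perm.graph_connected_iff, Equiv.Perm.sameCycle_conj]
  exact ⟨fun h u v => by simpa using h (σ u) (σ v), fun h u v => h _ _⟩

/-- The endpoints of the edges at which the graphs of `π₁` and `π₂` may differ if these
permutations agree except at `a` and `b`. -/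
def changedEdge (π₁ π₂ : Equiv.Perm V) (a b : V) (r : Bool × Bool) : V × V :=
  (cond r.1 a b, cond r.2 (π₁ (cond r.1 a b)) (π₂ (cond r.1 a b)))

theorem changedEdge_conj (π₁ π₂ σ : Equiv.Perm V) (a b : V) (r : Bool × Bool) :
    changedEdge (σ * π₁ * σ⁻¹) (σ * π₂ * σ⁻¹) (σ a) (σ b) r =
      Prod.map σ σ (changedEdge π₁ π₂ a b r) := by
  rcases r with ⟨_ | _, _ | _⟩ <;> simp [changedEdge]

/-- Only the arcs leaving `a` and `b` can change; the swap appears because adjacency forgets their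
direction. -/
theorem exists_changedEdge_of_graph_adj {π₁ π₂ : Equiv.Perm V} {a b : V}
    (h : ∀ u, u ≠ a → u ≠ b → π₁ u = π₂ u) {u v : V}
    (huv : ¬ (π₁.graph.Adj u v ↔ π₂.graph.Adj u v)) :
    ∃ r, changedEdge π₁ π₂ a b r = (u, v) ∨ (changedEdge π₁ π₂ a b r).swap = (u, v) := by
  simp only [Equiv.Perm.graph_adj] at huv
  have hu := h u
  have hv := h v
  simp only [Prod.exists, Bool.exists_bool, changedEdge, cond, Prod.swap, Prod.mk.injEq]
  by_cases h1 : u = a <;> by_cases h2 : u = b <;> by_cases h3 : v = a <;> by_cases h4 : v = b <;>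
    grind

theorem sum_le_sum_changedEdge [Fintype V] [DecidableEq V] {π₁ π₂ : Equiv.Perm V} {a b : V}
    (h : ∀ u, u ≠ a → u ≠ b → π₁ u = π₂ u) {F : V × V → ℝ} (hF : ∀ z, 0 ≤ F z)
    (S : Finset (V × V)) (hS : ∀ z ∈ S, ¬ (π₁.graph.Adj z.1 z.2 ↔ π₂.graph.Adj z.1 z.2)) :
    ∑ z ∈ S, F z ≤ ∑ r, F (changedEdge π₁ π₂ a b r) + ∑ r, F (changedEdge π₁ π₂ a b r).swap := by
  have hsub : S ⊆ univ.image (changedEdge π₁ π₂ a b) ∪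
      univ.image (fun r => (changedEdge π₁ π₂ a b r).swap) := by
    intro z hz
    obtain ⟨r, hr⟩ := exists_changedEdge_of_graph_adj h (hS z hz)
    simp only [mem_union, mem_image, mem_univ, true_and]
    exact hr.imp (fun h => ⟨r, h⟩) fun h => ⟨r, h⟩
  refine (sum_le_sum_of_subset_of_nonneg hsub fun z _ _ => hF z).trans ?_
  -- Adding the intersection splits the sum over the union into two sums.
  refine (le_add_of_nonneg_right (b := ∑ z ∈ univ.image (changedEdge π₁ π₂ a b) ∩
    univ.image (fun r => (changedEdge π₁ π₂ a b r).swap), F z)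
    (sum_nonneg fun z _ => hF z)).trans ?_
  rw [sum_union_inter]
  exact add_le_add (sum_image_le_of_nonneg fun z _ => hF z)
    (sum_image_le_of_nonneg fun z _ => hF z)

variable [Fintype V] [DecidableEq V]

/-- The total weight, over all relabellings `σ` of the vertices, that is given to the pair `z` of
vertices of the relabelled permutation `π`. -/
noncomputable def relabelledWeight (w : Equiv.Perm V → V × V → ℝ) (π : Equiv.Perm V) (z : V × V) :
    ℝ :=
  ∑ σ : Equiv.Perm V, w (σ * π * σ⁻¹) (Prod.map σ σ z)

/-- Moving `z i` by `h i`, which commutes with `π`, does not change its relabelled weight. The moved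
pairs are distinct, so for each `σ` they share a total weight of at most 1. -/
theorem sum_relabelledWeight_le {w : Equiv.Perm V → V × V → ℝ} (hw : ∀ π z, 0 ≤ w π z)
    (hw' : ∀ π, ∑ z, w π z ≤ 1) {π : Equiv.Perm V} {I : Type*} [Fintype I]
    (h : I → Equiv.Perm V) (hc : ∀ i, Commute (h i) π) (z : I → V × V)
    (hz : Function.Injective fun i => Prod.map (h i) (h i) (z i)) :
    ∑ i, relabelledWeight w π (z i) ≤ (Fintype.card V).factorial := by
  have key (i : I) : relabelledWeight w π (z i) =
      ∑ σ : Equiv.Perm V, w (σ * π * σ⁻¹) (Prod.map σ σ (Prod.map (h i) (h i) (z i))) := by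
    rw [relabelledWeight, ← Equiv.sum_comp (Equiv.mulRight (h i))]
    refine sum_congr rfl fun σ _ => ?_
    have h1 : σ * h i * π * (σ * h i)⁻¹ = σ * π * σ⁻¹ := by
      rw [mul_assoc σ, (hc i).eq]
      group
    simp only [Equiv.coe_mulRight, h1]
    rfl
  simp_rw [key]
  rw [sum_comm, ← Fintype.card_perm, ← card_univ, ← nsmul_one, nsmul_eq_mul, ← nsmul_eq_mul]
  refine sum_le_card_nsmul _ _ _ fun σ _ => le_trans ?_ (hw' (σ * π * σ⁻¹))
  have hinj : Function.Injective fun i => Prod.map σ σ (Prod.map (h i) (h i) (z i)) :=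
    (σ.injective.prodMap σ.injective).comp hz
  rw [← sum_image (f := w (σ * π * σ⁻¹)) hinj.injOn]
  exact sum_le_sum_of_subset_of_nonneg (subset_univ _) fun z _ _ => hw _ z

theorem Equiv.Perm.commute_cycleOf (π : Equiv.Perm V) (u : V) : Commute (π.cycleOf u) π := by
  by_cases h : π u = u
  · rw [(Equiv.Perm.cycleOf_eq_one_iff π).2 h]
    exact Commute.one_left _
  · exact (Equiv.Perm.self_mem_cycle_factors_commute
      (Equiv.Perm.cycleOf_mem_cycleFactorsFinset_iff.2 (Equiv.Perm.mem_support.2 h)))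

theorem mul_relabelledWeight_le {w : Equiv.Perm V → V × V → ℝ} (hw : ∀ π z, 0 ≤ w π z)
    (hw' : ∀ π, ∑ z, w π z ≤ 1) {π : Equiv.Perm V} {z : V × V} {m : ℕ}
    (h : Function.Injective fun i : Fin m => (π ^ (i : ℕ)) z.1) :
    m * relabelledWeight w π z ≤ (Fintype.card V).factorial := by
  have := sum_relabelledWeight_le hw hw' (π := π) (fun i : Fin m => π ^ (i : ℕ))
    (fun i => (Commute.refl π).pow_left _) (fun _ => z) fun i j hij => h (congrArg Prod.fst hij)
  simpa using this

/-- When the endpoints lie on different cycles, the two cycles can be rotated independently, giving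
`m ^ 2` images of `z` instead of `m`. -/
theorem sq_mul_relabelledWeight_le {w : Equiv.Perm V → V × V → ℝ} (hw : ∀ π z, 0 ≤ w π z)
    (hw' : ∀ π, ∑ z, w π z ≤ 1) {π : Equiv.Perm V} {z : V × V} {m : ℕ}
    (h₁ : Function.Injective fun i : Fin m => (π ^ (i : ℕ)) z.1)
    (h₂ : Function.Injective fun i : Fin m => (π ^ (i : ℕ)) z.2)
    (h : ¬ π.SameCycle z.1 z.2) :
    (m : ℝ) ^ 2 * relabelledWeight w π z ≤ (Fintype.card V).factorial := by
  have hfix₁ (j : ℕ) : (π.cycleOf z.2 ^ j) z.1 = z.1 :=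
    Equiv.Perm.pow_apply_eq_self_of_apply_eq_self
      (Equiv.Perm.cycleOf_apply_of_not_sameCycle fun h' => h h'.symm) j
  have hfix₂ (i j : ℕ) : (π.cycleOf z.1 ^ i) ((π ^ j) z.2) = (π ^ j) z.2 :=
    Equiv.Perm.pow_apply_eq_self_of_apply_eq_self
      (Equiv.Perm.cycleOf_apply_of_not_sameCycle fun h' => h (by simpa using h')) i
  have := sum_relabelledWeight_le hw hw' (π := π)
    (fun i : Fin m × Fin m => π.cycleOf z.1 ^ (i.1 : ℕ) * π.cycleOf z.2 ^ (i.2 : ℕ))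
    (fun i => ((π.commute_cycleOf _).pow_left _).mul_left ((π.commute_cycleOf _).pow_left _))
    (fun _ => z) ?_
  · simpa [sq] using this
  · intro i j hij
    simp only [Prod.map, Equiv.Perm.mul_apply, hfix₁, Equiv.Perm.cycleOf_pow_apply_self, hfix₂,
      Prod.mk.injEq] at hij
    exact Prod.ext (h₁ hij.1) (h₂ hij.2)

end PermutationGraphs

/-! ### One cycle against two cycles. -/

section Cycles

open Finset

variable {n : ℕ} [NeZero n]

/-- The permutation of `Fin n` with the single cycle `(0 1 ... n-1)`. -/
def oneCycle (n : ℕ) [NeZero n] : Equiv.Perm (Fin n) := Equiv.addRight 1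

/-- The permutation of `Fin n` with the two cycles `(1 ... k)` and `(0 k+1 ... n-1)`. -/
def twoCycles (k : Fin n) : Equiv.Perm (Fin n) := oneCycle n * Equiv.swap 0 k

theorem val_oneCycle {u : Fin n} (h : (u : ℕ) + 1 < n) : (oneCycle n u : ℕ) = u + 1 := by
  simp only [oneCycle, Equiv.coe_addRight, Fin.val_add, Fin.val_one', Nat.add_mod_mod]
  exact Nat.mod_eq_of_lt h

theorem val_oneCycle_of_eq {u : Fin n} (h : (u : ℕ) + 1 = n) : (oneCycle n u : ℕ) = 0 := by
  simp [oneCycle, Equiv.coe_addRight, Fin.val_add, Nat.add_mod_mod, h]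

theorem commute_addRight_oneCycle (a : Fin n) : Commute (Equiv.addRight a) (oneCycle n) := by
  ext u
  simp [oneCycle, add_right_comm]

theorem oneCycle_graph_connected : (oneCycle n).graph.Connected := by
  refine Equiv.Perm.graph_connected_iff.2 fun u v => ⟨((v - u : Fin n) : ℕ), ?_⟩
  have key (i : ℕ) : ((oneCycle n ^ i) u) = u + Fin.ofNat n i := by
    induction i with
    | zero => simp [Fin.ofNat]
    | succ i ih =>
      rw [pow_succ', Equiv.Perm.mul_apply, ih, oneCycle, Equiv.coe_addRight]
      simp only [add_assoc]
      congr 1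
      ext
      simp [Fin.val_add]
  rw [zpow_natCast, key]
  simp

theorem twoCycles_of_ne {k u : Fin n} (h₀ : u ≠ 0) (hk : u ≠ k) :
    twoCycles k u = oneCycle n u := by
  simp [twoCycles, Equiv.swap_apply_of_ne_of_ne h₀ hk]

theorem twoCycles_zero (k : Fin n) : twoCycles k 0 = oneCycle n k := by simp [twoCycles]

theorem twoCycles_self (k : Fin n) : twoCycles k k = oneCycle n 0 := by simp [twoCycles]

theorem twoCycles_mem_iff {k : Fin n} (hk : 0 < (k : ℕ)) (hkn : (k : ℕ) + 1 < n) (u : Fin n) :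
    (1 ≤ (twoCycles k u : ℕ) ∧ (twoCycles k u : ℕ) ≤ k) ↔ (1 ≤ (u : ℕ) ∧ (u : ℕ) ≤ k) := by
  by_cases h₀ : u = 0
  · rw [h₀, twoCycles_zero, val_oneCycle hkn]
    simp
  by_cases h : u = k
  · have h1 : (oneCycle n 0 : ℕ) = 1 := val_oneCycle (u := 0) (by simp; omega)
    rw [h, twoCycles_self, h1]
    omega
  have h₀' : (u : ℕ) ≠ 0 := fun h' => h₀ (Fin.ext (by simpa using h'))
  have h' : (u : ℕ) ≠ k := fun h' => h (Fin.ext h')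
  rw [twoCycles_of_ne h₀ h]
  rcases (Nat.succ_le_of_lt u.isLt).lt_or_eq with hu | hu
  · rw [val_oneCycle hu]
    omega
  · rw [val_oneCycle_of_eq hu]
    omega

theorem Equiv.Perm.SameCycle.mem_iff {V : Type*} {π : Equiv.Perm V} {P : V → Prop}
    (hP : ∀ u, P (π u) ↔ P u) {u v : V} (h : π.SameCycle u v) : P u ↔ P v := by
  have key (i : ℕ) (u : V) : P ((π ^ i) u) ↔ P u := by
    induction i with
    | zero => rfl
    | succ i ih => rw [pow_succ', Equiv.Perm.mul_apply, hP, ih]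
  obtain ⟨i, rfl⟩ := h
  obtain ⟨j, rfl | rfl⟩ := i.eq_nat_or_neg
  · exact (key j u).symm
  · simpa using key j ((π ^ (-(j : ℤ))) u)

theorem not_sameCycle_twoCycles {k : Fin n} (hk : 0 < (k : ℕ)) (hkn : (k : ℕ) + 1 < n) :
    ¬ (twoCycles k).SameCycle 0 k := by
  intro h
  have h0 : ((0 : Fin n) : ℕ) = 0 := Fin.val_zero _
  have : (1 ≤ ((0 : Fin n) : ℕ) ∧ ((0 : Fin n) : ℕ) ≤ k) ↔ (1 ≤ (k : ℕ) ∧ (k : ℕ) ≤ k) :=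
    h.mem_iff (P := fun u : Fin n => 1 ≤ (u : ℕ) ∧ (u : ℕ) ≤ k) (twoCycles_mem_iff hk hkn)
  omega

theorem not_connected_twoCycles {k : Fin n} (hk : 0 < (k : ℕ)) (hkn : (k : ℕ) + 1 < n) :
    ¬ (twoCycles k).graph.Connected := fun h =>
  not_sameCycle_twoCycles hk hkn (Equiv.Perm.graph_connected_iff.1 h _ _)

/-- Within either arc `1, ..., k` or `k+1, ..., n-1` the permutation is the successor map, with no
wraparound. -/
theorem val_twoCycles_pow {k u : Fin n} {i : ℕ} (hu : 0 < (u : ℕ))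
    (h : ((u : ℕ) + i ≤ k) ∨ ((k : ℕ) < u ∧ (u : ℕ) + i < n)) :
    ((twoCycles k ^ i) u : ℕ) = u + i := by
  induction i with
  | zero => rfl
  | succ i ih =>
    have ih := ih (by omega)
    have hk := k.isLt
    rw [pow_succ', Equiv.Perm.mul_apply, twoCycles_of_ne, val_oneCycle, ih, add_assoc]
    · omega
    · intro h'
      rw [h'] at ih
      simp at ih
      omega
    · intro h'
      rw [h'] at ih
      omega

theorem injective_twoCycles_pow {k u : Fin n} {m : ℕ} (hu : 0 < (u : ℕ))
    (h : ((u : ℕ) + m ≤ k + 1) ∨ ((k : ℕ) < u ∧ (u : ℕ) + m ≤ n)) :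
    Function.Injective fun i : Fin m => (twoCycles k ^ (i : ℕ)) u := by
  intro i j hij
  have hi := i.isLt
  have hj := j.isLt
  have := congrArg Fin.val hij
  simp only at this
  rw [val_twoCycles_pow hu (by omega), val_twoCycles_pow hu (by omega)] at this
  exact Fin.ext (by omega)

theorem injective_pow_of_apply {V : Type*} {π : Equiv.Perm V} {u : V} {m : ℕ}
    (h : Function.Injective fun i : Fin m => (π ^ (i : ℕ)) (π u)) :
    Function.Injective fun i : Fin m => (π ^ (i : ℕ)) u := by
  intro i j hij
  apply h
  simp only [← Equiv.Perm.mul_apply, ← pow_succ] at hij ⊢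
  simpa only [pow_succ', Equiv.Perm.mul_apply] using congrArg π hij

theorem twoCycles_spec {k : Fin n} {m : ℕ} (hm : 0 < m) (hk : m ≤ (k : ℕ))
    (hkn : (k : ℕ) + 1 + m ≤ n) {s : Fin n} (hs : s = 0 ∨ s = k) :
    (Function.Injective fun i : Fin m => (twoCycles k ^ (i : ℕ)) s) ∧
    (Function.Injective fun i : Fin m => (twoCycles k ^ (i : ℕ)) (oneCycle n s)) ∧
    ¬ (twoCycles k).SameCycle s (oneCycle n s) := by
  have h1 : (oneCycle n 0 : ℕ) = 1 := val_oneCycle (u := 0) (by simp; omega)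
  have h2 : (oneCycle n k : ℕ) = k + 1 := val_oneCycle (by omega)
  have h3 : Function.Injective fun i : Fin m => (twoCycles k ^ (i : ℕ)) (oneCycle n 0) :=
    injective_twoCycles_pow (by omega) (by omega)
  have h4 : Function.Injective fun i : Fin m => (twoCycles k ^ (i : ℕ)) (oneCycle n k) :=
    injective_twoCycles_pow (by omega) (by omega)
  have h5 := not_sameCycle_twoCycles (k := k) (by omega) (by omega)
  rcases hs with rfl | rfl
  · refine ⟨injective_pow_of_apply (by rwa [twoCycles_zero]), h3, ?_⟩
    rwa [← twoCycles_self k, Equiv.Perm.sameCycle_apply_right]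
  · refine ⟨injective_pow_of_apply (by rwa [twoCycles_self]), h4, fun h => h5 ?_⟩
    rw [← twoCycles_zero, Equiv.Perm.sameCycle_apply_right] at h
    exact h.symm

/-- Rotations preserve the difference of a pair, so pairs with distinct differences have disjoint
orbits, each of size `n`. -/
theorem sum_relabelledWeight_oneCycle_le {w : Equiv.Perm (Fin n) → Fin n × Fin n → ℝ}
    (hw : ∀ π z, 0 ≤ w π z) (hw' : ∀ π, ∑ z, w π z ≤ 1) {I : Type*} [Fintype I]
    (z : I → Fin n × Fin n) (hz : Function.Injective fun i => (z i).2 - (z i).1) :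
    n * ∑ i, relabelledWeight w (oneCycle n) (z i) ≤ n.factorial := by
  have := sum_relabelledWeight_le hw hw' (π := oneCycle n) (I := Fin n × I)
    (fun i => Equiv.addRight i.1) (fun i => commute_addRight_oneCycle i.1) (fun i => z i.2) ?_
  · rw [Fintype.sum_prod_type] at this
    simpa using this
  · rintro ⟨a, i⟩ ⟨b, j⟩ hij
    simp only [Prod.map, Equiv.coe_addRight, Prod.mk.injEq] at hij
    have h : i = j := hz (by
      simp only
      rw [← add_sub_add_right_eq_sub _ _ a, hij.1, hij.2, add_sub_add_right_eq_sub])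
    subst h
    rw [add_left_cancel hij.1]

theorem sum_sqrt_changedEdge_le {w : Equiv.Perm (Fin n) → Fin n × Fin n → ℝ}
    (hw : ∀ π z, 0 ≤ w π z) (hw' : ∀ π, ∑ z, w π z ≤ 1) {m : ℕ} (hm : 0 < m)
    (κ : Fin m → Fin n) (hκ : Function.Injective κ) (hmκ : ∀ i, m ≤ (κ i : ℕ))
    (hκn : ∀ i, (κ i : ℕ) + 1 + m ≤ n) (r : Bool × Bool) :
    ∑ e : Fin m × Equiv.Perm (Fin n),
      √(w (e.2 * oneCycle n * e.2⁻¹)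
        (Prod.map e.2 e.2 (changedEdge (oneCycle n) (twoCycles (κ e.1)) 0 (κ e.1) r))) *
      √(w (e.2 * twoCycles (κ e.1) * e.2⁻¹)
        (Prod.map e.2 e.2 (changedEdge (oneCycle n) (twoCycles (κ e.1)) 0 (κ e.1) r))) ≤
      n.factorial / √n := by
  set z : Fin m → Fin n × Fin n :=
    fun i => changedEdge (oneCycle n) (twoCycles (κ i)) 0 (κ i) r with hz
  refine (Real.sum_sqrt_mul_sqrt_le _ (fun _ => hw _ _) fun _ => hw _ _).trans ?_
  rw [Fintype.sum_prod_type, Fintype.sum_prod_type]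
  change √(∑ i, relabelledWeight w (oneCycle n) (z i)) *
    √(∑ i, relabelledWeight w (twoCycles (κ i)) (z i)) ≤ _
  set X := ∑ i, relabelledWeight w (oneCycle n) (z i)
  set Y := ∑ i, relabelledWeight w (twoCycles (κ i)) (z i)
  have hX : 0 ≤ X := sum_nonneg fun _ _ => sum_nonneg fun _ _ => hw _ _
  have hY : 0 ≤ Y := sum_nonneg fun _ _ => sum_nonneg fun _ _ => hw _ _
  have hn : (0 : ℝ) < n := Nat.cast_pos.2 (NeZero.pos n)
  have hm' : (0 : ℝ) < m := Nat.cast_pos.2 hm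
  have hs (i : Fin m) : (z i).1 = 0 ∨ (z i).1 = κ i := by
    simp only [hz, changedEdge]
    cases r.1 <;> simp
  suffices h : n * (X * Y) ≤ (n.factorial : ℝ) ^ 2 by
    rw [← Real.sqrt_mul hX, le_div_iff₀ (Real.sqrt_pos.2 hn), ← Real.sqrt_mul (by positivity)]
    exact Real.sqrt_le_iff.2 ⟨by positivity, by linarith⟩
  rcases r with ⟨r₁, _ | _⟩
  · have h1 : n * X ≤ n.factorial := by
      refine sum_relabelledWeight_oneCycle_le hw hw' z fun i j hij => hκ ?_
      cases r₁ <;>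
        simpa [hz, changedEdge, twoCycles_zero, twoCycles_self, oneCycle] using hij
    have h2 : m * Y ≤ m * n.factorial := by
      have (i : Fin m) := mul_relabelledWeight_le hw hw'
        (twoCycles_spec hm (hmκ i) (hκn i) (hs i)).1
      simp only [Fintype.card_fin] at this
      rw [mul_sum]
      simpa using sum_le_card_nsmul univ _ _ fun i _ => this i
    have h2 := le_of_mul_le_mul_left h2 hm'
    calc n * (X * Y) = n * X * Y := by ring
      _ ≤ _ := by rw [sq]; gcongr
  -- Edges of the one cycle: all have difference 1, which costs a factor `m` in `X`, but they join
  -- the two cycles, which gains it back in `Y`.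
  · have h1 : n * X ≤ m * n.factorial := by
      have (i : Fin m) := sum_relabelledWeight_oneCycle_le hw hw' (fun _ : Unit => z i)
        (Function.injective_of_subsingleton _)
      rw [mul_sum]
      simpa using sum_le_card_nsmul univ _ _ fun i _ => this i
    have h2 : m * (m * Y) ≤ m * n.factorial := by
      have (i : Fin m) : (m : ℝ) ^ 2 * relabelledWeight w (twoCycles (κ i)) (z i) ≤
          n.factorial := by
        have hz2 : (z i).2 = oneCycle n (z i).1 := rfl
        obtain ⟨ha, hb, hc⟩ := twoCycles_spec hm (hmκ i) (hκn i) (hs i)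
        simpa using sq_mul_relabelledWeight_le hw hw' ha (by rwa [hz2]) (by rwa [hz2])
      rw [← mul_assoc, ← sq, mul_sum]
      simpa using sum_le_card_nsmul univ _ _ fun i _ => this i
    have h2 := le_of_mul_le_mul_left h2 hm'
    refine le_of_mul_le_mul_left ?_ hm'
    calc m * (n * (X * Y)) = n * X * (m * Y) := by ring
      _ ≤ m * n.factorial * n.factorial := by gcongr
      _ = _ := by ring

theorem sum_sqrt_queryWeight_le (A : QuantumQueryAlgorithm (Fin n × Fin n)) (t : ℕ) {m : ℕ}
    (hm : 0 < m) (κ : Fin m → Fin n) (hκ : Function.Injective κ) (hmκ : ∀ i, m ≤ (κ i : ℕ))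
    (hκn : ∀ i, (κ i : ℕ) + 1 + m ≤ n) :
    ∑ e : Fin m × Equiv.Perm (Fin n),
      ∑ z with adjacencyBits (e.2 * oneCycle n * e.2⁻¹).graph z ≠
          adjacencyBits (e.2 * twoCycles (κ e.1) * e.2⁻¹).graph z,
        √(A.queryWeight (adjacencyBits (e.2 * oneCycle n * e.2⁻¹).graph) t z) *
        √(A.queryWeight (adjacencyBits (e.2 * twoCycles (κ e.1) * e.2⁻¹).graph) t z) ≤
      8 * (n.factorial / √n) := by
  set w : Equiv.Perm (Fin n) → Fin n × Fin n → ℝ :=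
    fun π z => A.queryWeight (adjacencyBits π.graph) t z
  have hw (π z) : 0 ≤ w π z := A.queryWeight_nonneg _ _ _
  have hw' (π) : ∑ z, w π z ≤ 1 := (A.sum_queryWeight _ _).le
  have hws (π) : ∑ z : Fin n × Fin n, w π z.swap ≤ 1 :=
    ((Equiv.prodComm (Fin n) (Fin n)).sum_comp (w π)).trans_le (hw' π)
  have h1 := sum_le_sum fun r (_ : r ∈ (univ : Finset (Bool × Bool))) =>
    sum_sqrt_changedEdge_le hw hw' hm κ hκ hmκ hκn r
  -- Reversed arcs are handled by swapping the weight; four arcs in two orientations give the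
  -- constant 8.
  have h2 := sum_le_sum fun r (_ : r ∈ (univ : Finset (Bool × Bool))) =>
    sum_sqrt_changedEdge_le (w := fun π z => w π z.swap) (fun _ _ => hw _ _) hws hm κ hκ hmκ hκn r
  rw [sum_comm] at h1 h2
  have h3 := add_le_add h1 h2
  rw [← sum_add_distrib] at h3
  refine (sum_le_sum fun e _ => ?_).trans (h3.trans_eq ?_)
  · simp only [← changedEdge_conj]
    refine sum_le_sum_changedEdge (F := fun z => √(w (e.2 * oneCycle n * e.2⁻¹) z) *
      √(w (e.2 * twoCycles (κ e.1) * e.2⁻¹) z)) (fun u h₀ hk => ?_) (fun z => by positivity) _ ?_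
    · simp only [Equiv.Perm.mul_apply]
      rw [twoCycles_of_ne]
      · rintro h
        exact h₀ (by rw [← h]; simp)
      · rintro h
        exact hk (by rw [← h]; simp)
    · intro z hz
      exact fun h => (mem_filter.1 hz).2 (decide_eq_decide.2 h)
  · simp
    ring

end Cycles

/-! ### The lower bound. -/

theorem mainTheorem3 (ε : ℝ) (hε₀ : 0 ≤ ε) (hε : ε < 1 / 2) :
    ∃ c : ℝ, 0 < c ∧ ∃ n₀ : ℕ, ∀ n : ℕ, n₀ ≤ n →
      ∀ A : QuantumQueryAlgorithm (Fin n × Fin n), DecidesConnectivity A ε →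
        c * (n : ℝ) ^ (3 / 2 : ℝ) ≤ (A.queries : ℝ) := by
  have hδ : √(1 - (1 - 2 * ε) ^ 2) < 1 := by
    rw [Real.sqrt_lt' one_pos]
    nlinarith
  -- Here `96 = 2 * 8 * 6`: the adversary bound, the changed arcs, and `m ≥ n / 6`.
  refine ⟨(1 - √(1 - (1 - 2 * ε) ^ 2)) / 96, by linarith, 6, fun n hn A hA => ?_⟩
  have : NeZero n := ⟨by omega⟩
  have hn0 : (0 : ℝ) < n := by positivity
  let m := n / 3
  -- Cut points in the middle third leave at least `m` vertices on both cycles.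
  let κ : Fin m → Fin n := fun i => ⟨m + i, by omega⟩
  have hκ (i : Fin m) : (κ i : ℕ) = m + i := rfl
  have key := A.adversary_bound hε (Finset.univ : Finset (Fin m × Equiv.Perm (Fin n)))
    (fun e => adjacencyBits (e.2 * oneCycle n * e.2⁻¹).graph)
    (fun e => adjacencyBits (e.2 * twoCycles (κ e.1) * e.2⁻¹).graph)
    (fun e _ => (hA _).1 ((Equiv.Perm.graph_conj_connected_iff e.2).2 oneCycle_graph_connected))
    (fun e _ => (hA _).2 fun h => not_connected_twoCycles
      (by have := hκ e.1; omega) (by have := hκ e.1; omega)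
      ((Equiv.Perm.graph_conj_connected_iff e.2).1 h))
    (fun t => sum_sqrt_queryWeight_le A t (by omega) κ
      (fun i j h => Fin.ext (by have := congrArg Fin.val h; simp only [hκ] at this; omega))
      (fun i => by rw [hκ]; omega) (fun i => by rw [hκ]; omega))
  have hm : (n : ℝ) / 6 ≤ m := by
    have : n ≤ 6 * m := by omega
    have : (n : ℝ) ≤ 6 * m := by exact_mod_cast this
    linarith
  have hfac : (0 : ℝ) < n.factorial := by positivity
  have hsqrt : 0 < √(n : ℝ) := Real.sqrt_pos.2 hn0
  rw [Finset.card_univ, Fintype.card_prod, Fintype.card_fin, Fintype.card_perm, Fintype.card_fin,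
    Nat.cast_mul] at key
  have key' : (1 - √(1 - (1 - 2 * ε) ^ 2)) * m * √n ≤ 16 * A.queries := by
    refine le_of_mul_le_mul_left ?_ (div_pos hfac hsqrt)
    calc n.factorial / √n * ((1 - √(1 - (1 - 2 * ε) ^ 2)) * m * √n)
        = (1 - √(1 - (1 - 2 * ε) ^ 2)) * (m * n.factorial) := by field_simp
      _ ≤ _ := key
      _ = _ := by ring
  have hpow : (n : ℝ) ^ (3 / 2 : ℝ) = n * √n := by
    rw [show (3 / 2 : ℝ) = 1 + 1 / 2 by norm_num, Real.rpow_add hn0, Real.rpow_one,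
      Real.sqrt_eq_rpow]
  rw [hpow]
  have : (1 - √(1 - (1 - 2 * ε) ^ 2)) * (n / 6) * √n ≤
      (1 - √(1 - (1 - 2 * ε) ^ 2)) * m * √n := by
    have := sub_nonneg.2 hδ.le
    gcongr
  linarith
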